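/- Conventions. For a poset $P$ and $A\subseteq P$ let $\uparrow A=\{x\in P:\exists a\in A,\ a\le x\}$, and $\uparrow x=\uparrow\{x\}$; directed sets are non-empty. For $x,y\in P$, $x\ll y$ means that every directed $D\subseteq P$ having a supremum with $y\le\bigvee D$ contains some $d\ge x$; for $F,G\subseteq P$, $F\ll G$ means that every directed $D\subseteq P$ having a supremum with $\bigvee D\in\uparrow G$ meets $\uparrow F$ (empty sets are allowed, so $\emptyset\ll\emptyset$). $P$ is continuous if for every $x$ the set $\{d: d\ll x\}$ is directed with supremum $x$; a continuous lattice is a complete lattice that is continuous. $\sigma(P)$ is the Scott topology of $P$ (the upper sets $U$ such that every directed $D$ with an existing supremum in $U$ meets $U$), ordered by inclusion, and $\upsilon(P)$ is the upper topology, generated by the sets $P\setminus\{y : y\le x\}$, $x\in P$. $L^{op}$ is $L$ with the reversed order. **Proposition.** Let $L$ be a distributive continuous lattice with $\sigma(L^{op})=\upsilon(L^{op})$. (1) The map $I:L\to\sigma(L^{op})$, $I(x)=L\setminus\uparrow x$, preserves arbitrary sups. (2) For $U\in\sigma(L^{op})$ put $K_U=\bigcap\{\uparrow F: F\subseteq L\text{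 finite},\ L\setminus\uparrow F\subseteq U\}$. Then $$U=\bigcup\{L\setminus\uparrow F: F\subseteq L\text{ finite},\ L\setminus\uparrow F\subseteq U\}=L\setminus K_U,\qquad K_U=\bigcap\{\uparrow F: F\subseteq L\text{ finite},\ F\ll K_U\}.$$ The set $\{\bigwedge F: F\subseteq L\text{ finite},\ F\ll K_U\}$ is directed. Define $J:\sigma(L^{op})\to L$ by letting $J(U)$ be its supremum, $$J(U)=\bigvee\{\textstyle\bigwedge F: F\subseteq L\text{ finite},\ F\ll K_U\}.$$ Then $J$ preserves arbitrary sups, $J\circ I=\mathrm{id}_L$ and $I\circ J\le \mathrm{id}_{\sigma(L^{op})}$; $(J,I)$ is an adjunction with $I$ the lower and $J$ the upper adjoint, that is, $I(x)\subseteq U\iff x\le J(U)$ for all $x\in L$, $U\in\sigma(L^{op})$; and $J$ also preserves arbitrary infs. -/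

import Mathlib

open Set

namespace DualScott

section Poset

variable {P : Type*} [PartialOrder P]

/-- `x ≪ y`: every (non-empty) directed set whose least upper bound exists and lies above `y`
has an element above `x`. -/
def WayBelow (x y : P) : Prop :=
  ∀ D : Set P, D.Nonempty → DirectedOn (· ≤ ·) D →
    ∀ s : P, IsLUB D s → y ≤ s → ∃ d ∈ D, x ≤ d

/-- `↑A`, the set of all points above some point of `A`. -/
def up (A : Set P) : Set P := {x | ∃ a ∈ A, a ≤ x}

/-- `F ≪ G` for subsets: every (non-empty) directed set whose least upper bound exists and lies
in `↑G` meets `↑F`. The empty set is allowed on both sides. -/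
def SetWayBelow (F G : Set P) : Prop :=
  ∀ D : Set P, D.Nonempty → DirectedOn (· ≤ ·) D →
    ∀ s : P, IsLUB D s → s ∈ up G → (D ∩ up F).Nonempty

variable (P) in
/-- A poset is continuous if every point is the directed supremum of the points way below it. -/
def IsContinuousPoset : Prop :=
  ∀ x : P, {d : P | WayBelow d x}.Nonempty ∧ DirectedOn (· ≤ ·) {d : P | WayBelow d x} ∧
    IsLUB {d : P | WayBelow d x} x

variable (P) in
/-- `σ(P)`, the complete lattice of Scott open subsets of `P`, ordered by inclusion. -/
abbrev ScottOpens : Type _ := @TopologicalSpace.Opens P (Topology.scott P univ)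

end Poset

section CompleteLattice

variable {L : Type*} [CompleteLattice L]

/-- An element `U` of `σ(Lᵒᵖ)` regarded as a subset of `L`. -/
def toSet (U : ScottOpens Lᵒᵈ) : Set L := {x : L | OrderDual.toDual x ∈ U}

/-- The complement of a principal filter of `L` is Scott open in `Lᵒᵖ`. -/
theorem isOpen_compl_Ici (x : L) :
    @IsOpen Lᵒᵈ (Topology.scott Lᵒᵈ univ) (OrderDual.ofDual ⁻¹' (Ici x)ᶜ : Set Lᵒᵈ) := by
  let _ : TopologicalSpace Lᵒᵈ := Topology.scott Lᵒᵈ univ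
  have : Topology.IsScott Lᵒᵈ univ := ⟨rfl⟩
  have h : (OrderDual.ofDual ⁻¹' (Ici x)ᶜ : Set Lᵒᵈ) = (Iic (OrderDual.toDual x))ᶜ := rfl
  rw [h, isOpen_compl_iff, Topology.IsScott.isClosed_iff_isLowerSet_and_dirSupClosed]
  exact ⟨isLowerSet_Iic _, dirSupClosed_Iic _⟩

/-- The map `I : L → σ(Lᵒᵖ)`, `I(x) = L ∖ ↑x`. -/
def I (x : L) : ScottOpens Lᵒᵈ :=
  @TopologicalSpace.Opens.mk Lᵒᵈ (Topology.scott Lᵒᵈ univ)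
    (OrderDual.ofDual ⁻¹' (Ici x)ᶜ) (isOpen_compl_Ici x)

/-- `K_U`, the intersection of all `↑F` with `F ⊆ L` finite and `L ∖ ↑F ⊆ U`. -/
def K (U : ScottOpens Lᵒᵈ) : Set L :=
  ⋂₀ {A : Set L | ∃ F : Set L, F.Finite ∧ (up F)ᶜ ⊆ toSet U ∧ A = up F}

/-- The set of all infima `⋀ F` with `F ⊆ L` finite and `F ≪ K_U`. -/
def infs (U : ScottOpens Lᵒᵈ) : Set L :=
  {a : L | ∃ F : Set L, F.Finite ∧ SetWayBelow F (K U) ∧ a = sInf F}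

/-- The map `J : σ(Lᵒᵖ) → L`, sending `U` to the supremum of all `⋀ F` with `F` finite and
`F ≪ K_U`. -/
def J (U : ScottOpens Lᵒᵈ) : L := sSup (infs U)

end CompleteLattice

end DualScott

namespace DualScott

section WayBelow

variable {L : Type*} [CompleteLattice L]

/-! Since `σ(Lᵒᵖ) = υ(Lᵒᵖ)`, `K U` is the complement of `U`, and continuity gives `J U = sInf (K
U)`. Hence `I x ≤ U` iff `x` is a lower bound of `K U` iff `x ≤ J U`; the adjunction yields
everything except that `J` preserves sups. That needs primes: `K U` is an intersection of finitely
generated upper sets, so it contains every prime above its infimum, and a distributive continuous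
lattice has enough primes to test inequalities. -/

theorem WayBelow.le {x y : L} (h : WayBelow x y) : x ≤ y := by
  obtain ⟨d, hd, hxd⟩ := h {y} (singleton_nonempty y) (directedOn_singleton y) y
    isLUB_singleton le_rfl
  rw [mem_singleton_iff] at hd
  exact hd ▸ hxd

theorem WayBelow.trans_le {x y z : L} (h : WayBelow x y) (hyz : y ≤ z) : WayBelow x z :=
  fun D hne hD s hs hz => h D hne hD s hs (hyz.trans hz)

theorem WayBelow.le_trans {x y z : L} (hxy : x ≤ y) (h : WayBelow y z) : WayBelow x z :=
  fun D hne hD s hs hz =>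
    let ⟨d, hd, hyd⟩ := h D hne hD s hs hz
    ⟨d, hd, hxy.trans hyd⟩

/-- In a continuous lattice, an element not below `y` has an approximant not below `y`. -/
theorem exists_wayBelow_not_le (hcont : IsContinuousPoset L) {x y : L} (h : ¬ x ≤ y) :
    ∃ d, WayBelow d x ∧ ¬ d ≤ y := by
  by_contra! hd
  exact h ((hcont x).2.2.2 fun d hdx => hd d hdx)

/-- The way-below relation of a continuous lattice is interpolative. -/
theorem WayBelow.interpolate (hcont : IsContinuousPoset L) {x z : L} (h : WayBelow x z) :
    ∃ y, WayBelow x y ∧ WayBelow y z := by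
  let D : Set L := {d | ∃ y, WayBelow d y ∧ WayBelow y z}
  have hne : D.Nonempty := by
    obtain ⟨y, hy⟩ := (hcont z).1
    obtain ⟨d, hd⟩ := (hcont y).1
    exact ⟨d, y, hd, hy⟩
  have hdir : DirectedOn (· ≤ ·) D := by
    rintro d ⟨y, hdy, hyz⟩ d' ⟨y', hdy', hyz'⟩
    obtain ⟨w, hw, hyw, hyw'⟩ := (hcont z).2.1 y hyz y' hyz'
    obtain ⟨e, he, hde, hde'⟩ :=
      (hcont w).2.1 d (hdy.trans_le hyw) d' (hdy'.trans_le hyw')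
    exact ⟨e, ⟨w, he, hw⟩, hde, hde'⟩
  have hz : z ≤ sSup D :=
    (hcont z).2.2.2 fun y hy => (hcont y).2.2.2 fun d hd => le_sSup ⟨y, hd, hy⟩
  obtain ⟨d, ⟨y, hdy, hyz⟩, hxd⟩ := h D hne hdir _ (isLUB_sSup D) hz
  exact ⟨y, hdy.le_trans hxd, hyz⟩

/-- Below `a` and above `c ≪ a` there is a decreasing sequence for the way-below relation. -/
theorem WayBelow.exists_seq (hcont : IsContinuousPoset L) {c a : L} (h : WayBelow c a) :
    ∃ u : ℕ → L, WayBelow (u 0) a ∧ (∀ n, c ≤ u n) ∧ ∀ n, WayBelow (u (n + 1)) (u n) := by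
  choose f hf using fun y : {y : L // WayBelow c y} => y.2.interpolate hcont
  let v : ℕ → {y : L // WayBelow c y} := fun n =>
    Nat.rec ⟨f ⟨a, h⟩, (hf ⟨a, h⟩).1⟩ (fun _ y => ⟨f y, (hf y).1⟩) n
  exact ⟨fun n => (v n).1, (hf ⟨a, h⟩).2, fun n => (v n).2.le, fun n => (hf (v n)).2⟩

/-- Distributive continuous lattices have enough primes. -/
theorem exists_infPrime_of_not_le (hdist : ∀ a b c : L, a ⊓ (b ⊔ c) = (a ⊓ b) ⊔ (a ⊓ c))
    (hcont : IsContinuousPoset L) {a b : L} (hab : ¬ a ≤ b) :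
    ∃ p, InfPrime p ∧ b ≤ p ∧ ¬ a ≤ p := by
  obtain ⟨c, hca, hcb⟩ := exists_wayBelow_not_le hcont hab
  obtain ⟨u, hu0, hcu, hu⟩ := hca.exists_seq hcont
  have hanti : Antitone u := antitone_nat_of_succ_le fun n => (hu n).le
  -- `V` is a filter because `u` decreases, and Scott open because `u (n + 1) ≪ u n`; so Zorn gives
  -- a maximal `p ≥ b` outside `V`, and distributivity makes it prime.
  let V : Set L := {x | ∃ n, u n ≤ x}
  have hbV : b ∉ V := fun ⟨n, hn⟩ => hcb ((hcu n).trans hn)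
  obtain ⟨p, hbp, hp⟩ := zorn_le_nonempty₀ Vᶜ (fun C hCV hC y hy => by
    refine ⟨sSup C, ?_, fun z hz => le_sSup hz⟩
    rintro ⟨n, hn⟩
    obtain ⟨d, hd, hnd⟩ := hu n C ⟨y, hy⟩ hC.directedOn _ (isLUB_sSup C) hn
    exact hCV hd ⟨n + 1, hnd⟩) b hbV
  have hV : ∀ x, ¬ x ≤ p → p ⊔ x ∈ V := fun x hx => by
    by_contra hxV
    exact hx (le_sup_right.trans (hp.2 hxV le_sup_left))
  refine ⟨p, ⟨fun hmax => hp.1 ⟨0, le_top.trans (hmax le_top)⟩, fun {x y} hxy => ?_⟩, hbp,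
    fun hap => hp.1 ⟨0, hu0.le.trans hap⟩⟩
  by_contra! hcon
  obtain ⟨m, hm⟩ := hV x hcon.1
  obtain ⟨n, hn⟩ := hV y hcon.2
  refine hp.1 ⟨max m n, ?_⟩
  calc u (max m n) ≤ (p ⊔ x) ⊓ (p ⊔ y) :=
        le_inf ((hanti (le_max_left m n)).trans hm) ((hanti (le_max_right m n)).trans hn)
    _ = (p ⊔ x) ⊓ p ⊔ (p ⊔ x) ⊓ y := hdist _ _ _
    _ ≤ p := by
        refine sup_le inf_le_right ?_
        rw [inf_comm, hdist]
        exact sup_le inf_le_right (inf_comm x y ▸ hxy)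

theorem exists_le_of_sInf_le_infPrime {p : L} (hp : InfPrime p) {F : Set L} (hF : F.Finite)
    (h : sInf F ≤ p) : ∃ f ∈ F, f ≤ p := by
  lift F to Finset L using hF
  obtain ⟨f, hf, hfp⟩ := hp.finset_inf_le.1
    (show F.inf id ≤ p by rwa [Finset.inf_id_eq_sInf])
  exact ⟨f, hf, hfp⟩

theorem SetWayBelow.subset_up {F G : Set L} (h : SetWayBelow F G) : G ⊆ up F := by
  intro x hx
  obtain ⟨d, hd, hdF⟩ := h {x} (singleton_nonempty x) (directedOn_singleton x) x
    isLUB_singleton ⟨x, hx, le_rfl⟩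
  rw [mem_singleton_iff] at hd
  exact hd ▸ hdF

theorem SetWayBelow.image2_sup {F F' G : Set L} (h : SetWayBelow F G) (h' : SetWayBelow F' G) :
    SetWayBelow (image2 (· ⊔ ·) F F') G := by
  intro D hne hD s hs hsG
  obtain ⟨d, hd, f, hf, hfd⟩ := h D hne hD s hs hsG
  obtain ⟨d', hd', f', hf', hfd'⟩ := h' D hne hD s hs hsG
  obtain ⟨e, he, hde, hde'⟩ := hD d hd d' hd'
  exact ⟨e, he, f ⊔ f', mem_image2_of_mem hf hf', sup_le (hfd.trans hde) (hfd'.trans hde')⟩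

theorem setWayBelow_singleton {x : L} {G : Set L} (h : ∀ y ∈ G, WayBelow x y) :
    SetWayBelow {x} G := by
  rintro D hne hD s hs ⟨y, hy, hys⟩
  obtain ⟨d, hd, hxd⟩ := h y hy D hne hD s hs hys
  exact ⟨d, hd, x, rfl, hxd⟩

end WayBelow

section Adjunction

variable {L : Type*} [CompleteLattice L]

/-- The sets `(up F)ᶜ` with `F` finite form a basis of the upper topology of `Lᵒᵈ`. -/
theorem exists_finite_notMem_up (hσυ : Topology.scott Lᵒᵈ univ = Topology.upper Lᵒᵈ)
    (U : ScottOpens Lᵒᵈ) {x : L} (hx : x ∈ toSet U) :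
    ∃ F : Set L, F.Finite ∧ (up F)ᶜ ⊆ toSet U ∧ x ∉ up F := by
  have hU : @IsOpen Lᵒᵈ (Topology.upper Lᵒᵈ) {y : Lᵒᵈ | y ∈ U} :=
    hσυ ▸ @TopologicalSpace.Opens.isOpen Lᵒᵈ (Topology.scott Lᵒᵈ univ) U
  let _ : TopologicalSpace Lᵒᵈ := Topology.upper Lᵒᵈ
  have : Topology.IsUpper Lᵒᵈ := ⟨rfl⟩
  obtain ⟨_, ⟨F, hF, rfl⟩, hxF, hFU⟩ :=
    (Topology.IsUpper.isTopologicalBasis (α := Lᵒᵈ)).exists_subset_of_mem_open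
      (show OrderDual.toDual x ∈ {y : Lᵒᵈ | y ∈ U} from hx) hU
  exact ⟨OrderDual.toDual ⁻¹' F, hF, hFU, hxF⟩

theorem toSet_eq_sUnion (hσυ : Topology.scott Lᵒᵈ univ = Topology.upper Lᵒᵈ)
    (U : ScottOpens Lᵒᵈ) :
    toSet U = ⋃₀ {A : Set L | ∃ F : Set L,
      F.Finite ∧ (up F)ᶜ ⊆ toSet U ∧ A = (up F)ᶜ} := by
  refine Subset.antisymm (fun x hx => ?_) (sUnion_subset ?_)
  · obtain ⟨F, hF, hFU, hxF⟩ := exists_finite_notMem_up hσυ U hx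
    exact ⟨_, ⟨F, hF, hFU, rfl⟩, hxF⟩
  · rintro _ ⟨F, -, hFU, rfl⟩
    exact hFU

theorem mem_K_iff (hσυ : Topology.scott Lᵒᵈ univ = Topology.upper Lᵒᵈ)
    (U : ScottOpens Lᵒᵈ) {x : L} : x ∈ K U ↔ x ∉ toSet U := by
  constructor
  · intro hx hxU
    obtain ⟨F, hF, hFU, hxF⟩ := exists_finite_notMem_up hσυ U hxU
    exact hxF (hx _ ⟨F, hF, hFU, rfl⟩)
  · rintro hx _ ⟨F, -, hFU, rfl⟩
    by_contra hxF
    exact hx (hFU hxF)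

theorem K_eq_sInter (hcont : IsContinuousPoset L)
    (U : ScottOpens Lᵒᵈ) :
    K U = ⋂₀ {A : Set L | ∃ F : Set L, F.Finite ∧ SetWayBelow F (K U) ∧ A = up F} := by
  refine Subset.antisymm ?_ fun x hx => ?_
  · rintro x hx _ ⟨F, -, hFK, rfl⟩
    exact hFK.subset_up hx
  · rintro _ ⟨F, hF, hFU, rfl⟩
    by_contra hxF
    have hf : ∀ f ∈ F, ∃ d, WayBelow d f ∧ ¬ d ≤ x := fun f hfF =>
      exists_wayBelow_not_le hcont fun hfx => hxF ⟨f, hfF, hfx⟩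
    -- Shrinking each generator `f` to some `g f ≪ f` still not below `x` keeps `x` outside the
    -- upper set and makes `g '' F ≪ K U`.
    choose! g hg hgx using hf
    have hK : SetWayBelow (g '' F) (K U) := by
      rintro D hne hD s hs ⟨k, hk, hks⟩
      obtain ⟨f, hfF, hfk⟩ := hk _ ⟨F, hF, hFU, rfl⟩
      obtain ⟨d, hd, hgd⟩ := hg f hfF D hne hD s hs (hfk.trans hks)
      exact ⟨d, hd, g f, mem_image_of_mem g hfF, hgd⟩
    obtain ⟨_, ⟨f, hfF, rfl⟩, hfx⟩ := hx _ ⟨_, hF.image g, hK, rfl⟩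
    exact hgx f hfF hfx

theorem infs_nonempty (U : ScottOpens Lᵒᵈ) : (infs U).Nonempty :=
  ⟨sInf {⊥}, {⊥}, finite_singleton ⊥, setWayBelow_singleton
    fun _ _ _ ⟨d, hd⟩ _ _ _ _ => ⟨d, hd, bot_le⟩, rfl⟩

theorem directedOn_infs (U : ScottOpens Lᵒᵈ) : DirectedOn (· ≤ ·) (infs U) := by
  rintro _ ⟨F, hF, hFK, rfl⟩ _ ⟨G, hG, hGK, rfl⟩
  refine ⟨_, ⟨_, hF.image2 _ hG, hFK.image2_sup hGK, rfl⟩, le_sInf ?_, le_sInf ?_⟩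
  · rintro _ ⟨f, hf, g, -, rfl⟩
    exact (sInf_le hf).trans le_sup_left
  · rintro _ ⟨f, -, g, hg, rfl⟩
    exact (sInf_le hg).trans le_sup_right

/-- Singletons suffice for `≥`: if `d ≪ sInf (K U)`, then `{d} ≪ K U`. -/
theorem J_eq_sInf_K (hcont : IsContinuousPoset L) (U : ScottOpens Lᵒᵈ) : J U = sInf (K U) := by
  refine le_antisymm (sSup_le ?_) ((hcont _).2.2.2 fun d hd => ?_)
  · rintro _ ⟨F, -, hFK, rfl⟩
    refine le_sInf fun k hk => ?_
    obtain ⟨f, hf, hfk⟩ := hFK.subset_up hk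
    exact (sInf_le hf).trans hfk
  · exact le_sSup ⟨{d}, finite_singleton d,
      setWayBelow_singleton fun y hy => hd.trans_le (sInf_le hy), sInf_singleton.symm⟩

theorem gc_I_J (hcont : IsContinuousPoset L)
    (hσυ : Topology.scott Lᵒᵈ univ = Topology.upper Lᵒᵈ) :
    GaloisConnection (I : L → ScottOpens Lᵒᵈ) J := by
  intro x U
  rw [J_eq_sInf_K hcont, le_sInf_iff]
  constructor
  · intro h y hy
    by_contra hxy
    exact (mem_K_iff hσυ U).1 hy (h (show OrderDual.toDual y ∈ I x from hxy))
  · intro h y hy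
    by_contra hyU
    exact hy (h (OrderDual.ofDual y) ((mem_K_iff hσυ U).2 hyU))

theorem J_I (hcont : IsContinuousPoset L)
    (hσυ : Topology.scott Lᵒᵈ univ = Topology.upper Lᵒᵈ) (x : L) : J (I x) = x := by
  refine le_antisymm ?_ ((gc_I_J hcont hσυ).le_u_l x)
  rw [J_eq_sInf_K hcont]
  exact sInf_le ((mem_K_iff hσυ _).2 fun h => h le_rfl)

/-- Each `up F` in the intersection has `sInf F ≤ p`, and a prime above a finite meet is above one
of its members. -/
theorem mem_K_of_sInf_le_infPrime (U : ScottOpens Lᵒᵈ) {p : L} (hp : InfPrime p)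
    (h : sInf (K U) ≤ p) : p ∈ K U := by
  rintro _ ⟨F, hF, hFU, rfl⟩
  refine exists_le_of_sInf_le_infPrime hp hF (le_trans (le_sInf fun k hk => ?_) h)
  obtain ⟨f, hf, hfk⟩ := hk _ ⟨F, hF, hFU, rfl⟩
  exact (sInf_le hf).trans hfk

theorem J_sSup (hdist : ∀ a b c : L, a ⊓ (b ⊔ c) = (a ⊓ b) ⊔ (a ⊓ c))
    (hcont : IsContinuousPoset L)
    (hσυ : Topology.scott Lᵒᵈ univ = Topology.upper Lᵒᵈ) (S : Set (ScottOpens Lᵒᵈ)) :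
    J (sSup S) = sSup (J '' S) := by
  refine le_antisymm ?_ (sSup_le ?_)
  -- A prime separating the two sides lies in `K U` for all `U ∈ S`, hence outside the union `sSup
  -- S`.
  · by_contra hle
    obtain ⟨p, hp, hSp, hpS⟩ := exists_infPrime_of_not_le hdist hcont hle
    refine hpS ?_
    rw [J_eq_sInf_K hcont]
    refine sInf_le ((mem_K_iff hσυ _).2 fun hpU => ?_)
    obtain ⟨U, hU, hpU⟩ := (@TopologicalSpace.Opens.mem_sSup Lᵒᵈ (Topology.scott Lᵒᵈ univ)
      S (OrderDual.toDual p)).1 hpU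
    refine (mem_K_iff hσυ U).1 (mem_K_of_sInf_le_infPrime U hp ?_) hpU
    rw [← J_eq_sInf_K hcont]
    exact (le_sSup (mem_image_of_mem J hU)).trans hSp
  · rintro _ ⟨U, hU, rfl⟩
    exact (gc_I_J hcont hσυ).monotone_u (le_sSup hU)

end Adjunction

end DualScott

theorem mainTheorem9 {L : Type*} [CompleteLattice L]
    (hdist : ∀ a b c : L, a ⊓ (b ⊔ c) = (a ⊓ b) ⊔ (a ⊓ c))
    (hcont : DualScott.IsContinuousPoset L)
    (hσυ : Topology.scott Lᵒᵈ Set.univ = Topology.upper Lᵒᵈ) :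
    -- `I` preserves arbitrary sups
    (∀ S : Set L, DualScott.I (sSup S) = sSup (DualScott.I '' S)) ∧
    -- the representations of `U` and of `K_U`
    (∀ U : DualScott.ScottOpens Lᵒᵈ,
      DualScott.toSet U = ⋃₀ {A : Set L | ∃ F : Set L,
        F.Finite ∧ (DualScott.up F)ᶜ ⊆ DualScott.toSet U ∧ A = (DualScott.up F)ᶜ} ∧
      DualScott.toSet U = (DualScott.K U)ᶜ ∧
      DualScott.K U = ⋂₀ {A : Set L | ∃ F : Set L,
        F.Finite ∧ DualScott.SetWayBelow F (DualScott.K U) ∧ A = DualScott.up F}) ∧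
    -- the supremum that defines `J U` is directed
    (∀ U : DualScott.ScottOpens Lᵒᵈ,
      (DualScott.infs U).Nonempty ∧ DirectedOn (· ≤ ·) (DualScott.infs U)) ∧
    -- `J` preserves arbitrary sups
    (∀ S : Set (DualScott.ScottOpens Lᵒᵈ), DualScott.J (sSup S) = sSup (DualScott.J '' S)) ∧
    -- `J ∘ I = id`
    (DualScott.J ∘ DualScott.I = (id : L → L)) ∧
    -- `I ∘ J ≤ id`
    (∀ U : DualScott.ScottOpens Lᵒᵈ, DualScott.I (DualScott.J U) ≤ U) ∧
    -- `I` is the lower adjoint and `J` the upper adjoint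
    GaloisConnection (DualScott.I : L → DualScott.ScottOpens Lᵒᵈ) DualScott.J ∧
    -- `J` preserves arbitrary infs
    (∀ S : Set (DualScott.ScottOpens Lᵒᵈ), DualScott.J (sInf S) = sInf (DualScott.J '' S)) := by
  have gc := DualScott.gc_I_J hcont hσυ
  refine ⟨fun S => ?_, fun U => ⟨DualScott.toSet_eq_sUnion hσυ U, ?_,
    DualScott.K_eq_sInter hcont U⟩, fun U => ⟨DualScott.infs_nonempty U,
    DualScott.directedOn_infs U⟩, DualScott.J_sSup hdist hcont hσυ,
    funext (DualScott.J_I hcont hσυ), gc.l_u_le, gc, fun S => ?_⟩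
  · rw [gc.l_sSup, sSup_image]
  · ext x
    rw [Set.mem_compl_iff, DualScott.mem_K_iff hσυ, not_not]
  · rw [gc.u_sInf, sInf_image]
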